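/- Let $G=(V,E,W)$ be a finite weighted undirected graph without loops, with symmetric weight matrix $W$, $w_{ij}\ge 0$, and $w_{ij}>0$ if and only if $\{i,j\}\in E$ (an unweighted graph is the case in which all nonzero weights equal $1$). Let $L=D-W$ be its Laplacian, where $D=\operatorname{diag}(d_1,\dots,d_n)$ with $d_i=\sum_j w_{ij}$, let $\rho(L)$ be the spectral radius of $L$, and for $\alpha\in(0,1)$ let $L^\alpha=U\operatorname{diag}(\lambda_1^\alpha,\dots,\lambda_n^\alpha)U^T$, where $L=U\operatorname{diag}(\lambda_1,\dots,\lambda_n)U^T$ is a spectral decomposition of $L$ with $U$ orthogonal. Let $d(i,j)$ be the length of a shortest path (number of edges) from $i$ to $j$ in $G$, with $d(i,j)=\infty$ if there is none. Then for all $\alpha\in(0,1)$, all $t>0$ and all vertices $i,j$ with $d(i,j)\ge 2$, $$|(L^\alpha)_{ij}|\le c\,\frac{\rho(L)^\alpha}{2^\alpha}\,[d(i,j)-1]^{-\alpha},$$ $$|\exp(-tL^\alpha)_{ij}|\le c\left[1-\exp\!\left(-t\,\frac{\rho(L)^\alpha}{2^\alpha}[d(i,j)-1]^{-\alpha}\right)\right]\le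 c\,t\,\frac{\rho(L)^\alpha}{2^\alpha}\,[d(i,j)-1]^{-\alpha},$$ with $c=1+\pi^2/2$. Here $[d(i,j)-1]^{-\alpha}$ is read as $0$ if $d(i,j)=\infty$; that is, in this case $(L^\alpha)_{ij}=\exp(-tL^\alpha)_{ij}=0$. -/

import Mathlib

/-- A weighted undirected loop-less graph: a simple graph together with a symmetric matrix of
nonnegative weights such that `weight i j` is positive exactly when `i` and `j` are adjacent.
An unweighted graph is the case in which all positive weights are equal to one. -/
structure WeightedGraph (V : Type*) where
  /-- the underlying graph -/
  graph : SimpleGraph V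
  /-- the weight matrix `W` -/
  weight : Matrix V V ℝ
  weight_symm : ∀ i j, weight i j = weight j i
  weight_nonneg : ∀ i j, 0 ≤ weight i j
  weight_pos_iff : ∀ i j, 0 < weight i j ↔ graph.Adj i j

namespace WeightedGraph

variable {V : Type*} [Fintype V]

/-- The weighted degree of a vertex (non-neighbours contribute zero to the sum). -/
def degree (G : WeightedGraph V) (i : V) : ℝ := ∑ j, G.weight i j

variable [DecidableEq V]

/-- The graph Laplacian `L = D - W`. -/
def laplacian (G : WeightedGraph V) : Matrix V V ℝ :=
  Matrix.diagonal G.degree - G.weight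

theorem isHermitian_laplacian (G : WeightedGraph V) : G.laplacian.IsHermitian := by
  refine (Matrix.isHermitian_diagonal G.degree).sub ?_
  ext i j
  simpa using G.weight_symm j i

/-- The fractional graph Laplacian `L ^ α = U diag(λ₁ ^ α, …, λₙ ^ α) Uᵀ`, where
`L = U diag(λ₁, …, λₙ) Uᵀ` is the spectral decomposition of the Laplacian. -/
noncomputable def fracLaplacian (G : WeightedGraph V) (α : ℝ) : Matrix V V ℝ :=
  G.isHermitian_laplacian.cfc (fun x => x ^ α)

/-- The spectral radius `ρ(L)` of the Laplacian, as a real number.  All eigenvalues of the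
real symmetric matrix `L` are real, so the real spectrum is the whole spectrum. -/
noncomputable def laplacianRadius (G : WeightedGraph V) : ℝ :=
  (spectralRadius ℝ G.laplacian).toReal

end WeightedGraph

/-!
If `p` is a polynomial of degree less than `d(i,j)`, then `p(L)_{ij} = 0`, because `(L ^ m)_{ij}`
is a sum over walks (with pauses) of `m` steps from `i` to `j`. Hence for any function `f`
`|f(L)_{ij}| = |(f - p)(L)_{ij}| ≤ sup |f - p|`, the supremum being over the spectrum of `L`, which
lies in `[0, ρ(L)]` by Gershgorin's theorem (`abs_cfc_laplacian_apply_le`). If there is no path from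
`i` to `j`, interpolating `f` on the spectrum gives `f(L)_{ij} = 0`.

It remains to approximate `f` by polynomials of degree `n = d(i,j) - 1`, which is Jackson's theorem
(`exists_polynomial_abs_sub_le`). Put `x = cos θ` and average `f ∘ cos` against the Fejér–Korovkin
kernel, the nonnegative trigonometric polynomial of degree `n` whose first Fourier coefficient is
`cos (π / (n + 2))` times its constant one. Averaging over the `n + 2` equidistant nodes
`2 π r / (n + 2)` is exact for trigonometric polynomials of degree at most `n + 1`, so no integrals
are needed. Estimating `|cos θ - cos s|` by the chord `2 |sin ((θ + s) / 2)|` instead of the arc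
yields the error `(1 + π) ω(1 / n)`, and `1 + π ≤ 1 + π² / 2`.

The theorem applies this to `x ^ α` and to `exp (-t x ^ α)`, rescaled from `[0, ρ(L)]` to
`[-1, 1]`; their moduli of continuity are `(ρ(L) / 2) ^ α u ^ α` and
`1 - exp (-t (ρ(L) / 2) ^ α u ^ α)`, and both satisfy `ω (v / n) ≤ (1 + v) ω (1 / n)`.
-/

/-! ### Trigonometric sums over equidistant nodes -/

open Finset in
theorem sum_cos_equidistant {N : ℕ} {m : ℤ} (hm : m ≠ 0) (hmN : |m| < N) (θ : ℝ) :
    ∑ r ∈ range N, Real.cos (m * (θ + 2 * Real.pi * r / N)) = 0 := by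
  have hN : (0 : ℝ) < N := by
    have := (abs_pos.2 hm).trans hmN
    exact_mod_cast this
  set δ : ℝ := m * Real.pi / N with hδ
  have hsin : Real.sin δ ≠ 0 := by
    intro h0
    obtain ⟨k, hk⟩ := Real.sin_eq_zero_iff.1 h0
    have hkm : (k * N : ℝ) = m := by
      have : (k * N : ℝ) * Real.pi = m * Real.pi := by
        rw [hδ] at hk
        field_simp at hk
        linear_combination Real.pi * hk
      exact mul_right_cancel₀ Real.pi_ne_zero this
    have hkm' : k * N = m := by exact_mod_cast hkm
    have hk0 : k ≠ 0 := by rintro rfl; simp at hkm'; exact hm hkm'.symm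
    have : (N : ℤ) ≤ |m| := by
      rw [← hkm', abs_mul, Nat.abs_cast]
      nlinarith [Int.one_le_abs hk0]
    omega
  -- Multiplied by `2 sin δ`, with `2 δ` the step of the phase, the sum telescopes.
  have htel : ∀ r : ℕ, 2 * Real.sin δ * Real.cos (m * (θ + 2 * Real.pi * r / N)) =
      Real.sin (m * θ + (2 * ((r + 1 : ℕ) : ℝ) - 1) * δ)
        - Real.sin (m * θ + (2 * (r : ℝ) - 1) * δ) := by
    intro r
    rw [Real.sin_sub_sin]
    have h1 : (m * θ + (2 * ((r + 1 : ℕ) : ℝ) - 1) * δ - (m * θ + (2 * (r : ℝ) - 1) * δ)) / 2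
        = δ := by push_cast; ring
    have h2 : (m * θ + (2 * ((r + 1 : ℕ) : ℝ) - 1) * δ + (m * θ + (2 * (r : ℝ) - 1) * δ)) / 2
        = m * (θ + 2 * Real.pi * r / N) := by rw [hδ]; push_cast; ring
    rw [h1, h2]
  have hsum : 2 * Real.sin δ * ∑ r ∈ range N, Real.cos (m * (θ + 2 * Real.pi * r / N)) = 0 := by
    rw [mul_sum, sum_congr rfl fun r _ => htel r,
      sum_range_sub (fun r : ℕ => Real.sin (m * θ + (2 * (r : ℝ) - 1) * δ))]
    have h3 : m * θ + (2 * (N : ℝ) - 1) * δ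
        = m * θ + (2 * ((0 : ℕ) : ℝ) - 1) * δ + m * (2 * Real.pi) := by
      rw [hδ]; field_simp; push_cast; ring
    rw [h3, Real.sin_add_int_mul_two_pi, sub_self]
  exact (mul_eq_zero.1 hsum).resolve_left (mul_ne_zero two_ne_zero hsin)

open Finset in
theorem sum_cos_equidistant_eq_ite {N : ℕ} {m : ℤ} (hmN : |m| < N) (θ : ℝ) :
    ∑ r ∈ range N, Real.cos (m * (θ + 2 * Real.pi * r / N)) = if m = 0 then (N : ℝ) else 0 := by
  split_ifs with h
  · simp [h]
  · exact sum_cos_equidistant h hmN θ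

/-! ### The Fejér–Korovkin kernel -/

/-- The coefficients `sin ((k + 1) π / (n + 2))` of the Fejér–Korovkin kernel. -/
noncomputable def korovkinCoeff (n k : ℕ) : ℝ := Real.sin ((k + 1) * (Real.pi / (n + 2)))

/-- The (unnormalised) Fejér–Korovkin kernel `|∑ aₖ exp (i k x)|²`, a nonnegative even
trigonometric polynomial of degree `n`. -/
noncomputable def korovkinKernel (n : ℕ) (x : ℝ) : ℝ :=
  (∑ k ∈ Finset.range (n + 1), korovkinCoeff n k * Real.cos (k * x)) ^ 2 +
    (∑ k ∈ Finset.range (n + 1), korovkinCoeff n k * Real.sin (k * x)) ^ 2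

/-- The constant Fourier coefficient of the Fejér–Korovkin kernel. -/
noncomputable def korovkinMass (n : ℕ) : ℝ := ∑ k ∈ Finset.range (n + 1), korovkinCoeff n k ^ 2

theorem korovkinKernel_nonneg (n : ℕ) (x : ℝ) : 0 ≤ korovkinKernel n x := by
  unfold korovkinKernel; positivity

theorem korovkinMass_pos (n : ℕ) : 0 < korovkinMass n := by
  refine Finset.sum_pos' (fun _ _ => sq_nonneg _) ⟨0, by simp, ?_⟩
  have : 0 < korovkinCoeff n 0 := by
    refine Real.sin_pos_of_pos_of_lt_pi (by positivity) ?_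
    simp only [Nat.cast_zero, zero_add, one_mul]
    exact div_lt_self Real.pi_pos (by linarith [(Nat.cast_nonneg n : (0 : ℝ) ≤ n)])
  positivity

open Finset in
theorem korovkinKernel_eq_sum (n : ℕ) (x : ℝ) :
    korovkinKernel n x = ∑ k ∈ range (n + 1), ∑ l ∈ range (n + 1),
      korovkinCoeff n k * korovkinCoeff n l * Real.cos (((k : ℤ) - l : ℤ) * x) := by
  rw [korovkinKernel, sq, sq, sum_mul_sum, sum_mul_sum, ← sum_add_distrib]
  refine sum_congr rfl fun k _ => ?_
  rw [← sum_add_distrib]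
  refine sum_congr rfl fun l _ => ?_
  push_cast
  rw [sub_mul, Real.cos_sub]
  ring

open Finset in
theorem sum_korovkinKernel (n : ℕ) (θ : ℝ) :
    ∑ r ∈ range (n + 2), korovkinKernel n (θ + 2 * Real.pi * r / (n + 2 : ℕ)) =
      (n + 2 : ℕ) * korovkinMass n := by
  simp_rw [korovkinKernel_eq_sum]
  rw [sum_comm, korovkinMass, mul_sum]
  refine sum_congr rfl fun k hk => ?_
  rw [sum_comm]
  simp_rw [← mul_sum]
  rw [sum_eq_single_of_mem k hk]
  · rw [sum_cos_equidistant_eq_ite (by simp; positivity)]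
    simp
    ring
  · intro l hl hlk
    rw [mem_range] at hk hl
    rw [sum_cos_equidistant (by omega) (by rw [abs_lt]; push_cast; omega), mul_zero]

open Finset in
/-- The defining property of the coefficients: they form a discrete Dirichlet eigenvector, so the
ratio of the first two Fourier coefficients of the kernel is `cos (π / (n + 2))`. -/
theorem sum_korovkinCoeff_mul_succ (n : ℕ) :
    ∑ k ∈ range (n + 1), korovkinCoeff n k * korovkinCoeff n (k + 1) =
      Real.cos (Real.pi / (n + 2)) * korovkinMass n := by
  set h : ℝ := Real.pi / (n + 2) with hh
  have key : ∀ k : ℕ, korovkinCoeff n k * korovkinCoeff n (k + 1)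
      - Real.cos h * korovkinCoeff n k ^ 2 =
      (Real.sin (((k + 1 : ℕ) : ℝ) * h) * Real.sin ((((k + 1 : ℕ) : ℝ) + 1) * h)
        - Real.sin ((k : ℝ) * h) * Real.sin (((k : ℝ) + 1) * h)) / 2 := by
    intro k
    simp only [korovkinCoeff, ← hh]
    push_cast
    have e1 : ((k : ℝ) + 1 + 1) * h = (k + 1) * h + h := by ring
    have e2 : (k : ℝ) * h = (k + 1) * h - h := by ring
    rw [e1, e2, Real.sin_add (((k : ℝ) + 1) * h) h, Real.sin_sub (((k : ℝ) + 1) * h) h]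
    ring
  rw [← sub_eq_zero, korovkinMass, mul_sum, ← sum_sub_distrib, sum_congr rfl fun k _ => key k,
    ← sum_div, sum_range_sub (fun k : ℕ => Real.sin ((k : ℝ) * h) * Real.sin (((k : ℝ) + 1) * h))]
  have e3 : (((n + 1 : ℕ) : ℝ) + 1) * h = Real.pi := by
    rw [hh]; push_cast; field_simp; ring
  rw [e3]
  simp

open Finset in
theorem sum_korovkinKernel_mul_cos (n : ℕ) (θ : ℝ) :
    ∑ r ∈ range (n + 2), korovkinKernel n (θ + 2 * Real.pi * r / (n + 2 : ℕ)) *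
        Real.cos (θ + 2 * Real.pi * r / (n + 2 : ℕ)) =
      (n + 2 : ℕ) * (Real.cos (Real.pi / (n + 2)) * korovkinMass n) := by
  -- The coefficient of index `n + 1` vanishes, so the sum over `l = k + 1` loses nothing at `k = n`.
  have hlast : korovkinCoeff n (n + 1) = 0 := by
    have : (((n + 1 : ℕ) : ℝ) + 1) * (Real.pi / (n + 2)) = Real.pi := by
      push_cast; field_simp; ring
    rw [korovkinCoeff, this, Real.sin_pi]
  have hprod : ∀ k l : ℕ, ∀ x : ℝ, korovkinCoeff n k * korovkinCoeff n l *
      Real.cos (((k : ℤ) - l : ℤ) * x) * Real.cos x =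
      korovkinCoeff n k * korovkinCoeff n l / 2 * Real.cos (((k : ℤ) - l + 1 : ℤ) * x) +
      korovkinCoeff n k * korovkinCoeff n l / 2 * Real.cos (((k : ℤ) - l - 1 : ℤ) * x) := by
    intro k l x
    push_cast
    have e1 : ((k : ℝ) - l + 1) * x = (k - l) * x + x := by ring
    have e2 : ((k : ℝ) - l - 1) * x = (k - l) * x - x := by ring
    rw [e1, e2, Real.cos_add, Real.cos_sub ((k - l : ℝ) * x)]
    ring
  have hshift : ∀ k ∈ range (n + 1), ∑ l ∈ range (n + 1), korovkinCoeff n k * korovkinCoeff n l / 2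
      * (if (k : ℤ) - l + 1 = 0 then ((n + 2 : ℕ) : ℝ) else 0) =
      (n + 2 : ℕ) / 2 * (korovkinCoeff n k * korovkinCoeff n (k + 1)) := by
    intro k hk
    rw [mem_range] at hk
    have : ∀ l : ℕ, ((k : ℤ) - l + 1 = 0) ↔ k + 1 = l := fun l => by omega
    simp_rw [this, mul_ite, mul_zero, sum_ite_eq]
    split_ifs with hmem
    · ring
    · have : k = n := by rw [mem_range] at hmem; omega
      rw [this, hlast]; ring
  simp_rw [korovkinKernel_eq_sum, sum_mul, hprod]
  rw [sum_comm, ← sum_korovkinCoeff_mul_succ]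
  have hcol : ∀ k ∈ range (n + 1), ∑ r ∈ range (n + 2), ∑ l ∈ range (n + 1),
      (korovkinCoeff n k * korovkinCoeff n l / 2 *
          Real.cos (((k : ℤ) - l + 1 : ℤ) * (θ + 2 * Real.pi * r / (n + 2 : ℕ))) +
        korovkinCoeff n k * korovkinCoeff n l / 2 *
          Real.cos (((k : ℤ) - l - 1 : ℤ) * (θ + 2 * Real.pi * r / (n + 2 : ℕ)))) =
      ∑ l ∈ range (n + 1), korovkinCoeff n k * korovkinCoeff n l / 2
        * (if (k : ℤ) - l + 1 = 0 then ((n + 2 : ℕ) : ℝ) else 0) +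
      ∑ l ∈ range (n + 1), korovkinCoeff n l * korovkinCoeff n k / 2
        * (if (l : ℤ) - k + 1 = 0 then ((n + 2 : ℕ) : ℝ) else 0) := by
    intro k hk
    rw [sum_comm, ← sum_add_distrib]
    refine sum_congr rfl fun l hl => ?_
    rw [mem_range] at hk hl
    rw [sum_add_distrib, ← mul_sum, ← mul_sum,
      sum_cos_equidistant_eq_ite (by rw [abs_lt]; push_cast; omega),
      sum_cos_equidistant_eq_ite (by rw [abs_lt]; push_cast; omega)]
    have : ((k : ℤ) - l - 1 = 0) ↔ ((l : ℤ) - k + 1 = 0) := by omega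
    rw [mul_comm (korovkinCoeff n l) (korovkinCoeff n k)]
    simp only [this]
  rw [sum_congr rfl hcol, sum_add_distrib]
  conv_lhs => rw [sum_comm (s := range (n + 1)) (t := range (n + 1)) (f := fun k l =>
    korovkinCoeff n l * korovkinCoeff n k / 2
        * (if (l : ℤ) - k + 1 = 0 then ((n + 2 : ℕ) : ℝ) else 0))]
  rw [sum_congr rfl hshift, ← mul_sum]
  ring

/-! ### Jackson's theorem -/

/-- A chord bound, made linear in `1 - cos` by the arithmetic–geometric mean inequality so that it
can be averaged against a kernel. -/
theorem abs_cos_sub_cos_le (x s : ℝ) {h : ℝ} (hh : 0 < h) :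
    |Real.cos x - Real.cos s| ≤ (2 * (1 - Real.cos (x + s)) + h ^ 2) / (2 * h) := by
  have h1 : |Real.cos x - Real.cos s| ≤ 2 * |Real.sin ((x + s) / 2)| := by
    rw [Real.cos_sub_cos, abs_mul, abs_mul]
    norm_num
    exact mul_le_of_le_one_right (by positivity) (Real.abs_sin_le_one _)
  have h2 : 1 - Real.cos (x + s) = 2 * |Real.sin ((x + s) / 2)| ^ 2 := by
    rw [sq_abs, Real.sin_sq_eq_half_sub, mul_div_cancel₀ _ (two_ne_zero' ℝ)]
    ring
  rw [h2, le_div_iff₀ (by positivity)]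
  nlinarith [sq_nonneg (2 * |Real.sin ((x + s) / 2)| - h)]

open Finset in
/-- The error bound for the kernel average centred at `-θ`. Jackson's theorem needs the mean of those
at `θ` and `-θ`, since only the even combination is a polynomial in `cos θ`. -/
theorem abs_sum_korovkinKernel_mul_sub_le {f : ℝ → ℝ} {M : ℝ} {n : ℕ} (hM : 0 ≤ M)
    (hf : ∀ x ∈ Set.Icc (-1 : ℝ) 1, ∀ y ∈ Set.Icc (-1 : ℝ) 1, |f x - f y| ≤ M * (1 + n * |x - y|))
    (θ : ℝ) :
    |∑ r ∈ range (n + 2), korovkinKernel n (θ + 2 * Real.pi * r / (n + 2 : ℕ)) *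
        (f (Real.cos θ) - f (Real.cos (2 * Real.pi * r / (n + 2 : ℕ))))| ≤
      (1 + Real.pi) * M * ((n + 2 : ℕ) * korovkinMass n) := by
  set h : ℝ := Real.pi / (n + 2) with hh
  have hpos : 0 < h := by positivity
  have hmass := korovkinMass_pos n
  have hcos : 1 - Real.cos h ≤ h ^ 2 / 2 := by linarith [Real.one_sub_sq_div_two_le_cos (x := h)]
  have hnh : n * h ≤ Real.pi := by
    rw [hh, ← mul_div_assoc, div_le_iff₀ (by positivity)]
    nlinarith [Real.pi_pos]
  calc _ ≤ ∑ r ∈ range (n + 2), korovkinKernel n (θ + 2 * Real.pi * r / (n + 2 : ℕ)) *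
        (M * (1 + n * ((2 * (1 - Real.cos (θ + 2 * Real.pi * r / (n + 2 : ℕ))) + h ^ 2)
          / (2 * h)))) := by
        refine (abs_sum_le_sum_abs _ _).trans (sum_le_sum fun r _ => ?_)
        rw [abs_mul, abs_of_nonneg (korovkinKernel_nonneg _ _)]
        refine mul_le_mul_of_nonneg_left ?_ (korovkinKernel_nonneg _ _)
        refine (hf _ (Real.cos_mem_Icc _) _ (Real.cos_mem_Icc _)).trans ?_
        gcongr
        exact abs_cos_sub_cos_le _ _ hpos
    _ = ∑ r ∈ range (n + 2), (M * (1 + n * ((2 + h ^ 2) / (2 * h))) *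
          korovkinKernel n (θ + 2 * Real.pi * r / (n + 2 : ℕ)) - M * n / h *
          (korovkinKernel n (θ + 2 * Real.pi * r / (n + 2 : ℕ)) *
            Real.cos (θ + 2 * Real.pi * r / (n + 2 : ℕ)))) := by
        refine sum_congr rfl fun r _ => ?_
        field_simp
        ring
    _ = M * (1 + n * ((2 * (1 - Real.cos h) + h ^ 2) / (2 * h))) *
          ((n + 2 : ℕ) * korovkinMass n) := by
        rw [sum_sub_distrib, ← mul_sum, ← mul_sum, sum_korovkinKernel, sum_korovkinKernel_mul_cos]
        field_simp
        ring
    _ ≤ M * (1 + n * ((2 * (h ^ 2 / 2) + h ^ 2) / (2 * h))) *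
          ((n + 2 : ℕ) * korovkinMass n) := by gcongr
    _ = M * (1 + n * h) * ((n + 2 : ℕ) * korovkinMass n) := by
        field_simp
        ring
    _ ≤ M * (1 + Real.pi) * ((n + 2 : ℕ) * korovkinMass n) := by gcongr
    _ = _ := by ring

open Finset Polynomial in
/-- Jackson's theorem on `[-1, 1]`, for functions whose modulus of continuity `ω` satisfies
`ω u ≤ M (1 + n u)`; for `n ≥ 1` this holds with `M = ω (1 / n)`, as
`ω` is monotone and subadditive. -/
theorem exists_polynomial_abs_sub_le {f : ℝ → ℝ} {M : ℝ} {n : ℕ} (hM : 0 ≤ M)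
    (hf : ∀ x ∈ Set.Icc (-1 : ℝ) 1, ∀ y ∈ Set.Icc (-1 : ℝ) 1,
      |f x - f y| ≤ M * (1 + n * |x - y|)) :
    ∃ p : ℝ[X], p.natDegree ≤ n ∧
      ∀ x ∈ Set.Icc (-1 : ℝ) 1, |f x - p.eval x| ≤ (1 + Real.pi) * M := by
  set s : ℕ → ℝ := fun r => 2 * Real.pi * r / (n + 2 : ℕ)
  set B : ℝ := (n + 2 : ℕ) * korovkinMass n with hB
  have hBpos : 0 < B := mul_pos (by positivity) (korovkinMass_pos n)
  let p : ℝ[X] := ∑ r ∈ range (n + 2), ∑ k ∈ range (n + 1), ∑ l ∈ range (n + 1),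
    C (f (Real.cos (s r)) / B * (korovkinCoeff n k * korovkinCoeff n l *
      Real.cos (((k : ℤ) - l : ℤ) * s r))) * Chebyshev.T ℝ ((k : ℤ) - l)
  -- The odd parts `sin sin` of the two kernel values cancel, leaving the Chebyshev sum `p`.
  have hp : ∀ θ, p.eval (Real.cos θ) = (∑ r ∈ range (n + 2),
      f (Real.cos (s r)) * (korovkinKernel n (θ + s r) + korovkinKernel n (-θ + s r))) / (2 * B) := by
    intro θ
    simp only [p, eval_finsetSum, eval_mul, eval_C, Chebyshev.T_real_cos]
    rw [sum_div]
    refine sum_congr rfl fun r _ => ?_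
    simp_rw [korovkinKernel_eq_sum, ← sum_add_distrib, mul_sum, sum_div]
    refine sum_congr rfl fun k _ => sum_congr rfl fun l _ => ?_
    rw [mul_add _ θ, mul_add _ (-θ), Real.cos_add, Real.cos_add, mul_neg, Real.cos_neg,
      Real.sin_neg]
    field_simp
    ring
  refine ⟨p, ?_, ?_⟩
  · refine natDegree_sum_le_of_forall_le _ _ fun r _ => natDegree_sum_le_of_forall_le _ _ fun k hk =>
      natDegree_sum_le_of_forall_le _ _ fun l hl => (natDegree_C_mul_le _ _).trans ?_
    rw [mem_range] at hk hl
    rw [Chebyshev.natDegree_T]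
    omega
  · intro x hx
    obtain ⟨θ, rfl⟩ : ∃ θ, Real.cos θ = x := ⟨_, Real.cos_arccos hx.1 hx.2⟩
    have h1 := abs_sum_korovkinKernel_mul_sub_le hM hf θ
    have h2 := abs_sum_korovkinKernel_mul_sub_le hM hf (-θ)
    have e : f (Real.cos θ) - p.eval (Real.cos θ) =
        (∑ r ∈ range (n + 2), korovkinKernel n (θ + s r) * (f (Real.cos θ) - f (Real.cos (s r))) +
        ∑ r ∈ range (n + 2), korovkinKernel n (-θ + s r) *
          (f (Real.cos (-θ)) - f (Real.cos (s r)))) / (2 * B) := by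
      have h3 : ∑ r ∈ range (n + 2), korovkinKernel n (θ + s r) = B := sum_korovkinKernel n θ
      have h4 : ∑ r ∈ range (n + 2), korovkinKernel n (-θ + s r) = B := sum_korovkinKernel n (-θ)
      simp_rw [hp, mul_sub, mul_add, Real.cos_neg, sum_sub_distrib, sum_add_distrib, ← sum_mul,
        h3, h4]
      simp_rw [mul_comm (f _)]
      field_simp
      ring
    rw [e, abs_div, abs_of_pos (by positivity : 0 < 2 * B), div_le_iff₀ (by positivity)]
    refine (abs_add_le _ _).trans ((add_le_add h1 h2).trans (le_of_eq ?_))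
    rw [hB]; ring

/-! ### Functions of a symmetric matrix -/

theorem Matrix.IsHermitian.cfc_apply_eq_sum {V : Type*} [Fintype V] [DecidableEq V]
    {A : Matrix V V ℝ} (hA : A.IsHermitian) (f : ℝ → ℝ) (i j : V) :
    hA.cfc f i j = ∑ k, (hA.eigenvectorUnitary : Matrix V V ℝ) i k *
      (hA.eigenvectorUnitary : Matrix V V ℝ) j k * f (hA.eigenvalues k) := by
  rw [Matrix.IsHermitian.cfc, Unitary.conjStarAlgAut_apply, Matrix.mul_apply]
  refine Finset.sum_congr rfl fun k _ => ?_
  simp [Matrix.mul_diagonal, Matrix.star_apply]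
  ring

theorem Matrix.sum_sq_eq_one_of_mem_unitaryGroup {V : Type*} [Fintype V] [DecidableEq V]
    (U : Matrix.unitaryGroup V ℝ) (i : V) : ∑ k, (U : Matrix V V ℝ) i k ^ 2 = 1 := by
  have h := congrFun (congrFun (Unitary.coe_mul_star_self U) i) i
  rw [Matrix.mul_apply, Matrix.one_apply_eq] at h
  rw [← h]
  exact Finset.sum_congr rfl fun k _ => by simp [Matrix.star_apply, sq]

theorem Matrix.IsHermitian.cfc_eval {V : Type*} [Fintype V] [DecidableEq V]
    {A : Matrix V V ℝ} (hA : A.IsHermitian) (p : Polynomial ℝ) :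
    hA.cfc (fun x => p.eval x) = Polynomial.aeval A p := by
  rw [← hA.cfc_eq]
  exact cfc_polynomial p A hA

/-- Entrywise, `f(A)` and `p(A)` differ by at most the uniform distance of `f` and `p` on the
spectrum, since the rows of the eigenvector matrix are unit vectors. -/
theorem Matrix.IsHermitian.abs_cfc_sub_aeval_apply_le {V : Type*} [Fintype V] [DecidableEq V]
    {A : Matrix V V ℝ} (hA : A.IsHermitian) {f : ℝ → ℝ} {p : Polynomial ℝ} {ε : ℝ}
    (h : ∀ k, |f (hA.eigenvalues k) - p.eval (hA.eigenvalues k)| ≤ ε) (i j : V) :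
    |(hA.cfc f - Polynomial.aeval A p) i j| ≤ ε := by
  set U : Matrix V V ℝ := (hA.eigenvectorUnitary : Matrix V V ℝ)
  have hi : ∑ k, U i k ^ 2 = 1 := Matrix.sum_sq_eq_one_of_mem_unitaryGroup _ i
  have hj : ∑ k, U j k ^ 2 = 1 := Matrix.sum_sq_eq_one_of_mem_unitaryGroup _ j
  rw [← hA.cfc_eval, Matrix.sub_apply, hA.cfc_apply_eq_sum, hA.cfc_apply_eq_sum,
    ← Finset.sum_sub_distrib]
  calc _ ≤ ∑ k, (U i k ^ 2 + U j k ^ 2) / 2 * ε := by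
        refine (Finset.abs_sum_le_sum_abs _ _).trans (Finset.sum_le_sum fun k _ => ?_)
        rw [← mul_sub, abs_mul]
        refine mul_le_mul ?_ (h k) (abs_nonneg _) (by positivity)
        rw [abs_mul, ← sq_abs (U i k), ← sq_abs (U j k)]
        nlinarith [sq_nonneg (|U i k| - |U j k|)]
    _ = ε := by
        rw [← Finset.sum_mul, ← Finset.sum_div, Finset.sum_add_distrib, hi, hj]
        ring

theorem Matrix.IsHermitian.exp_smul_cfc {V : Type*} [Fintype V] [DecidableEq V]
    {A : Matrix V V ℝ} (hA : A.IsHermitian) (f : ℝ → ℝ) (c : ℝ) :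
    NormedSpace.exp (c • hA.cfc f) = hA.cfc (fun x => Real.exp (c * f x)) := by
  set U : Matrix V V ℝ := (hA.eigenvectorUnitary : Matrix V V ℝ)
  have hmul : U * star U = 1 := Unitary.coe_mul_star_self _
  have hinv : U⁻¹ = star U := Matrix.inv_eq_right_inv hmul
  have hunit : IsUnit U := by
    rw [Matrix.isUnit_iff_isUnit_det]
    exact Matrix.isUnit_det_of_right_inverse hmul
  have hcfc : ∀ g : ℝ → ℝ, hA.cfc g = U * Matrix.diagonal (g ∘ hA.eigenvalues) * U⁻¹ := by
    intro g
    rw [Matrix.IsHermitian.cfc, Unitary.conjStarAlgAut_apply, hinv]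
    rfl
  rw [hcfc, hcfc, ← Matrix.smul_mul, ← Matrix.mul_smul, Matrix.exp_conj _ _ hunit,
    ← Matrix.diagonal_smul, Matrix.exp_diagonal]
  congr 3
  ext k
  rw [Pi.coe_exp]
  simp [Real.exp_eq_exp_ℝ]

/-! ### The spectrum and the powers of the Laplacian -/

namespace WeightedGraph

theorem weight_eq_zero_of_not_adj {V : Type*} (G : WeightedGraph V) {i j : V}
    (h : ¬ G.graph.Adj i j) : G.weight i j = 0 :=
  le_antisymm (not_lt.1 fun hpos => h ((G.weight_pos_iff i j).1 hpos)) (G.weight_nonneg i j)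

variable {V : Type*} [Fintype V] [DecidableEq V]

/-- The walk may be shorter than `m`, as the diagonal entries of the Laplacian allow pauses. -/
theorem exists_walk_of_laplacian_pow_apply_ne_zero (G : WeightedGraph V) {m : ℕ} {i j : V}
    (h : (G.laplacian ^ m) i j ≠ 0) : ∃ w : G.graph.Walk i j, w.length ≤ m := by
  induction m generalizing i with
  | zero =>
    have hij : i = j := by
      by_contra hne
      exact h (by rw [pow_zero, Matrix.one_apply_ne hne])
    subst hij
    exact ⟨.nil, le_rfl⟩
  | succ m ih =>
    rw [pow_succ', Matrix.mul_apply] at h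
    obtain ⟨k, -, hk⟩ := Finset.exists_ne_zero_of_sum_ne_zero h
    obtain ⟨w, hw⟩ := ih (right_ne_zero_of_mul hk)
    by_cases hik : i = k
    · subst hik
      exact ⟨w, hw.trans m.le_succ⟩
    · have hadj : G.graph.Adj i k := by
        by_contra hnot
        refine left_ne_zero_of_mul hk ?_
        rw [laplacian, Matrix.sub_apply, Matrix.diagonal_apply_ne _ hik,
          G.weight_eq_zero_of_not_adj hnot, sub_zero]
      exact ⟨.cons hadj w, by simpa using hw⟩

theorem aeval_laplacian_apply_eq_zero (G : WeightedGraph V) (p : Polynomial ℝ) {i j : V}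
    (h : ∀ w : G.graph.Walk i j, p.natDegree < w.length) :
    Polynomial.aeval G.laplacian p i j = 0 := by
  rw [Polynomial.aeval_eq_sum_range, Matrix.sum_apply]
  refine Finset.sum_eq_zero fun m hm => ?_
  rw [Matrix.smul_apply]
  by_contra hne
  obtain ⟨w, hw⟩ := G.exists_walk_of_laplacian_pow_apply_ne_zero (right_ne_zero_of_smul hne)
  have := h w
  rw [Finset.mem_range] at hm
  omega

/-- Gershgorin: every disc is centred at `dᵢ` with radius `dᵢ`. -/
theorem eigenvalues_laplacian_nonneg (G : WeightedGraph V) (k : V) :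
    0 ≤ G.isHermitian_laplacian.eigenvalues k := by
  have hev : Module.End.HasEigenvalue (Matrix.toLin' G.laplacian)
      (G.isHermitian_laplacian.eigenvalues k) := by
    rw [Module.End.hasEigenvalue_iff_mem_spectrum, Matrix.spectrum_toLin']
    exact G.isHermitian_laplacian.eigenvalues_mem_spectrum_real k
  obtain ⟨i, hi⟩ := eigenvalue_mem_ball hev
  have hdiag : G.laplacian i i = G.degree i := by
    rw [laplacian, Matrix.sub_apply, Matrix.diagonal_apply_eq,
      G.weight_eq_zero_of_not_adj (G.graph.irrefl (v := i)), sub_zero]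
  have hrow : ∑ j ∈ Finset.univ.erase i, ‖G.laplacian i j‖ ≤ G.degree i := by
    refine (Finset.sum_congr rfl fun j hj => ?_).trans_le
      (Finset.sum_le_sum_of_subset_of_nonneg (Finset.erase_subset i Finset.univ)
        fun j _ _ => G.weight_nonneg i j)
    rw [laplacian, Matrix.sub_apply, Matrix.diagonal_apply_ne _ (Finset.ne_of_mem_erase hj).symm,
      zero_sub, norm_neg, Real.norm_of_nonneg (G.weight_nonneg i j)]
  rw [Metric.mem_closedBall, hdiag, Real.dist_eq] at hi
  linarith [neg_le_of_abs_le (hi.trans hrow)]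

theorem eigenvalues_laplacian_le (G : WeightedGraph V) (k : V) :
    G.isHermitian_laplacian.eigenvalues k ≤ G.laplacianRadius := by
  set hL := G.isHermitian_laplacian
  have hfin : spectralRadius ℝ G.laplacian ≠ ⊤ := by
    rw [spectralRadius, hL.spectrum_real_eq_range_eigenvalues, iSup_range]
    refine ne_top_of_le_ne_top (ENNReal.coe_ne_top (r := Finset.univ.sup fun i =>
      ‖hL.eigenvalues i‖₊)) (iSup_le fun i => ENNReal.coe_le_coe.2 ?_)
    exact Finset.le_sup (f := fun i => ‖hL.eigenvalues i‖₊) (Finset.mem_univ i)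
  have hle : (‖hL.eigenvalues k‖₊ : ENNReal) ≤ spectralRadius ℝ G.laplacian :=
    le_iSup₂ (f := fun x (_ : x ∈ spectrum ℝ G.laplacian) => (‖x‖₊ : ENNReal)) _
      (hL.eigenvalues_mem_spectrum_real k)
  have := ENNReal.toReal_mono hfin hle
  exact (Real.le_norm_self _).trans (by simpa [laplacianRadius] using this)

end WeightedGraph

/-! ### Moduli of continuity -/

/-- Concavity of the modulus of continuity `u ↦ 1 - exp (-τ u ^ α)`. -/
theorem one_sub_exp_neg_mul_rpow_le {τ v α : ℝ} (hτ : 0 ≤ τ) (hv : 0 ≤ v) (hα0 : 0 ≤ α)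
    (hα1 : α ≤ 1) : 1 - Real.exp (-(τ * v ^ α)) ≤ (1 - Real.exp (-τ)) * (1 + v) := by
  have he : 0 ≤ 1 - Real.exp (-τ) := by
    have := Real.exp_le_one_iff.2 (neg_nonpos.2 hτ)
    linarith
  rcases le_total v 1 with h | h
  · have h1 : v ^ α ≤ 1 := Real.rpow_le_one hv h hα0
    have h2 : Real.exp (-τ) ≤ Real.exp (-(τ * v ^ α)) :=
      Real.exp_le_exp.2 (by nlinarith)
    nlinarith
  · have h1 : 1 ≤ v ^ α := Real.one_le_rpow h hα0
    have h2 : v ^ α ≤ v := by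
      simpa using Real.rpow_le_rpow_of_exponent_le h hα1
    have h3 := one_add_mul_self_le_rpow_one_add
      (s := Real.exp (-τ) - 1) (by linarith [Real.exp_pos (-τ)]) h1
    rw [add_sub_cancel, ← Real.exp_mul, neg_mul] at h3
    nlinarith

theorem abs_rpow_sub_rpow_le {x y α : ℝ} (hx : 0 ≤ x) (hy : 0 ≤ y) (hα0 : 0 ≤ α) (hα1 : α ≤ 1) :
    |x ^ α - y ^ α| ≤ |x - y| ^ α := by
  wlog h : y ≤ x generalizing x y
  · rw [abs_sub_comm, abs_sub_comm x]
    exact this hy hx (le_of_not_ge h)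
  have h1 := Real.rpow_add_le_add_rpow hy (sub_nonneg.2 h) hα0 hα1
  rw [add_sub_cancel] at h1
  rw [abs_of_nonneg (sub_nonneg.2 (Real.rpow_le_rpow hy h hα0)), abs_of_nonneg (sub_nonneg.2 h)]
  linarith

theorem abs_exp_neg_sub_exp_neg_le {u v : ℝ} (hu : 0 ≤ u) (hv : 0 ≤ v) :
    |Real.exp (-u) - Real.exp (-v)| ≤ 1 - Real.exp (-|u - v|) := by
  wlog h : u ≤ v generalizing u v
  · rw [abs_sub_comm, abs_sub_comm u]
    exact this hv hu (le_of_not_ge h)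
  rw [abs_of_nonneg (sub_nonneg.2 (Real.exp_le_exp.2 (neg_le_neg h))),
    abs_of_nonpos (sub_nonpos.2 h)]
  have e : Real.exp (-v) = Real.exp (-u) * Real.exp (-(-(u - v))) := by
    rw [← Real.exp_add]; ring_nf
  have h1 : Real.exp (-u) ≤ 1 := Real.exp_le_one_iff.2 (by linarith)
  have h2 : Real.exp (-(-(u - v))) ≤ 1 := Real.exp_le_one_iff.2 (by linarith)
  rw [e]
  nlinarith

/-- The modulus of continuity of `x ↦ (r (x + 1)) ^ α`, in units of the step `1 / n`. -/
theorem abs_rpow_mul_sub_rpow_mul_le {r α : ℝ} (hr : 0 ≤ r) (hα0 : 0 ≤ α) (hα1 : α ≤ 1) {n : ℝ}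
    (hn : 0 < n) {x y : ℝ} (hx : -1 ≤ x) (hy : -1 ≤ y) :
    |(r * (x + 1)) ^ α - (r * (y + 1)) ^ α| ≤ r ^ α * n ^ (-α) * (n * |x - y|) ^ α := by
  have hx' : 0 ≤ r * (x + 1) := mul_nonneg hr (by linarith)
  have hy' : 0 ≤ r * (y + 1) := mul_nonneg hr (by linarith)
  refine (abs_rpow_sub_rpow_le hx' hy' hα0 hα1).trans_eq ?_
  have e : r * (x + 1) - r * (y + 1) = r * (x - y) := by ring
  have h1 : n ^ (-α) * n ^ α = 1 := by
    rw [← Real.rpow_add hn, neg_add_cancel, Real.rpow_zero]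
  rw [e, abs_mul, abs_of_nonneg hr, Real.mul_rpow hr (abs_nonneg _),
    Real.mul_rpow hn.le (abs_nonneg _)]
  linear_combination (-(r ^ α * |x - y| ^ α)) * h1

/-! ### Decay of functions of the Laplacian -/

namespace WeightedGraph

variable {V : Type*} [Fintype V] [DecidableEq V]

/-- Jackson's theorem transported from `[-1, 1]` to the spectral interval `[0, ρ(L)]`. -/
theorem abs_cfc_laplacian_apply_le (G : WeightedGraph V) {f : ℝ → ℝ} {M : ℝ} {n : ℕ} {i j : V}
    (hM : 0 ≤ M) (hn : n < G.graph.dist i j)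
    (hf : ∀ x ∈ Set.Icc (-1 : ℝ) 1, ∀ y ∈ Set.Icc (-1 : ℝ) 1,
      |f (G.laplacianRadius / 2 * (x + 1)) - f (G.laplacianRadius / 2 * (y + 1))| ≤
        M * (1 + n * |x - y|)) :
    |G.isHermitian_laplacian.cfc f i j| ≤ (1 + Real.pi ^ 2 / 2) * M := by
  obtain ⟨q, hqdeg, hq⟩ := exists_polynomial_abs_sub_le hM hf
  set ρ := G.laplacianRadius
  let p : Polynomial ℝ := q.comp (Polynomial.C (2 / ρ) * Polynomial.X + Polynomial.C (-1))
  have hpdeg : p.natDegree ≤ n := by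
    refine Polynomial.natDegree_comp_le.trans ?_
    exact (Nat.mul_le_mul hqdeg (Polynomial.natDegree_linear_le)).trans_eq (mul_one n)
  have hpL : Polynomial.aeval G.laplacian p i j = 0 :=
    G.aeval_laplacian_apply_eq_zero p fun w =>
      hpdeg.trans_lt (hn.trans_le (SimpleGraph.dist_le w))
  have happrox : ∀ k, |f (G.isHermitian_laplacian.eigenvalues k) -
      p.eval (G.isHermitian_laplacian.eigenvalues k)| ≤ (1 + Real.pi) * M := by
    intro k
    set x := G.isHermitian_laplacian.eigenvalues k
    have hx0 : 0 ≤ x := G.eigenvalues_laplacian_nonneg k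
    have hx1 : x ≤ ρ := G.eigenvalues_laplacian_le k
    have hmem : 2 / ρ * x + -1 ∈ Set.Icc (-1 : ℝ) 1 := by
      have h0 : 0 ≤ x / ρ := div_nonneg hx0 (hx0.trans hx1)
      have h1 : x / ρ ≤ 1 := div_le_one_of_le₀ hx1 (hx0.trans hx1)
      have e : 2 / ρ * x = 2 * (x / ρ) := by ring
      rw [e]
      constructor <;> linarith
    -- For `ρ = 0` the only eigenvalue is `0`, so the rescaling is harmless despite `2 / 0 = 0`.
    have hback : ρ / 2 * (2 / ρ * x + -1 + 1) = x := by
      rcases eq_or_ne ρ 0 with h | h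
      · rw [h] at hx1 ⊢
        rw [le_antisymm hx1 hx0]
        simp
      · field_simp
        ring
    have := hq _ hmem
    rw [hback] at this
    simpa [p, Polynomial.eval_comp] using this
  have h := G.isHermitian_laplacian.abs_cfc_sub_aeval_apply_le happrox i j
  rw [Matrix.sub_apply, hpL, sub_zero] at h
  refine h.trans (mul_le_mul_of_nonneg_right ?_ hM)
  nlinarith [Real.two_le_pi]

/-- On the finite spectrum every function agrees with a polynomial. -/
theorem cfc_laplacian_apply_eq_zero (G : WeightedGraph V) (f : ℝ → ℝ) {i j : V}
    (h : ¬ G.graph.Reachable i j) : G.isHermitian_laplacian.cfc f i j = 0 := by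
  set hL := G.isHermitian_laplacian
  let p := Lagrange.interpolate (Finset.univ.image hL.eigenvalues) id f
  have hp : ∀ k, |f (hL.eigenvalues k) - p.eval (hL.eigenvalues k)| ≤ 0 := by
    intro k
    have := Lagrange.eval_interpolate_at_node (s := Finset.univ.image hL.eigenvalues) (v := id) f
      Function.injective_id.injOn (Finset.mem_image_of_mem _ (Finset.mem_univ k))
    rw [id] at this
    rw [this, sub_self, abs_zero]
  have h0 := hL.abs_cfc_sub_aeval_apply_le hp i j
  rw [Matrix.sub_apply, G.aeval_laplacian_apply_eq_zero p fun w => (h w.reachable).elim,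
    sub_zero] at h0
  exact abs_nonpos_iff.1 h0

theorem exp_smul_fracLaplacian (G : WeightedGraph V) (α c : ℝ) :
    NormedSpace.exp (c • G.fracLaplacian α) =
      G.isHermitian_laplacian.cfc (fun x => Real.exp (c * x ^ α)) :=
  G.isHermitian_laplacian.exp_smul_cfc _ c

end WeightedGraph

theorem mainTheorem4 {V : Type*} [Fintype V] [DecidableEq V] (G : WeightedGraph V)
    (α : ℝ) (hα0 : 0 < α) (hα1 : α < 1) (t : ℝ) (ht : 0 < t) (i j : V) :
    -- finite distance at least two
    (2 ≤ G.graph.dist i j →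
      |G.fracLaplacian α i j| ≤
          (1 + Real.pi ^ 2 / 2) *
            (G.laplacianRadius ^ α / 2 ^ α * ((G.graph.dist i j : ℝ) - 1) ^ (-α)) ∧
      |NormedSpace.exp (-t • G.fracLaplacian α) i j| ≤
          (1 + Real.pi ^ 2 / 2) *
            (1 - Real.exp (-t *
              (G.laplacianRadius ^ α / 2 ^ α * ((G.graph.dist i j : ℝ) - 1) ^ (-α)))) ∧
      (1 + Real.pi ^ 2 / 2) *
            (1 - Real.exp (-t *
              (G.laplacianRadius ^ α / 2 ^ α * ((G.graph.dist i j : ℝ) - 1) ^ (-α)))) ≤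
          (1 + Real.pi ^ 2 / 2) * t *
            (G.laplacianRadius ^ α / 2 ^ α * ((G.graph.dist i j : ℝ) - 1) ^ (-α))) ∧
    -- infinite distance, where the three upper bounds are all zero
    (¬ G.graph.Reachable i j →
      G.fracLaplacian α i j = 0 ∧ NormedSpace.exp (-t • G.fracLaplacian α) i j = 0) := by
  rw [G.exp_smul_fracLaplacian]
  refine ⟨fun hd => ?_, fun h =>
    ⟨G.cfc_laplacian_apply_eq_zero _ h, G.cfc_laplacian_apply_eq_zero _ h⟩⟩
  obtain ⟨n, hn⟩ : ∃ n, G.graph.dist i j = n + 1 := ⟨_, (Nat.sub_add_cancel (by omega)).symm⟩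
  have hn0 : (0 : ℝ) < n := by
    have : 0 < n := by omega
    exact_mod_cast this
  have hρ : 0 ≤ G.laplacianRadius := ENNReal.toReal_nonneg
  have hρ2 : 0 ≤ G.laplacianRadius / 2 := by positivity
  rw [hn, ← Real.div_rpow hρ zero_le_two, Nat.cast_add, Nat.cast_one, add_sub_cancel_right]
  set M : ℝ := (G.laplacianRadius / 2) ^ α * (n : ℝ) ^ (-α)
  have hM : 0 ≤ M := by positivity
  have hmod : ∀ x ∈ Set.Icc (-1 : ℝ) 1, ∀ y ∈ Set.Icc (-1 : ℝ) 1,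
      |(G.laplacianRadius / 2 * (x + 1)) ^ α - (G.laplacianRadius / 2 * (y + 1)) ^ α| ≤
        M * (n * |x - y|) ^ α :=
    fun x hx y hy => abs_rpow_mul_sub_rpow_mul_le hρ2 hα0.le hα1.le hn0 hx.1 hy.1
  refine ⟨?_, ?_, ?_⟩
  · refine G.abs_cfc_laplacian_apply_le hM (n := n) (by omega) fun x hx y hy => ?_
    refine (hmod x hx y hy).trans (mul_le_mul_of_nonneg_left ?_ hM)
    have hv : 0 ≤ n * |x - y| := by positivity
    rcases le_total (n * |x - y|) 1 with h | h
    · linarith [Real.rpow_le_one hv h hα0.le]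
    · have h1 : (n * |x - y|) ^ α ≤ n * |x - y| := by
        simpa using Real.rpow_le_rpow_of_exponent_le h hα1.le
      linarith
  · refine G.abs_cfc_laplacian_apply_le (n := n) ?_ (by omega) fun x hx y hy => ?_
    · rw [sub_nonneg, Real.exp_le_one_iff, neg_mul]
      exact neg_nonpos.2 (mul_nonneg ht.le hM)
    have hx' : 0 ≤ G.laplacianRadius / 2 * (x + 1) := mul_nonneg hρ2 (by linarith [hx.1])
    have hy' : 0 ≤ G.laplacianRadius / 2 * (y + 1) := mul_nonneg hρ2 (by linarith [hy.1])
    simp only [neg_mul]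
    refine (abs_exp_neg_sub_exp_neg_le (by positivity) (by positivity)).trans
      (le_trans ?_ (one_sub_exp_neg_mul_rpow_le (mul_nonneg ht.le hM)
        (by positivity : 0 ≤ n * |x - y|) hα0.le hα1.le))
    rw [← mul_sub, abs_mul, abs_of_pos ht, mul_assoc]
    have := mul_le_mul_of_nonneg_left (hmod x hx y hy) ht.le
    gcongr
  · rw [mul_assoc]
    refine mul_le_mul_of_nonneg_left ?_ (by positivity)
    have := Real.add_one_le_exp (-t * M)
    linarith
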